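/- **Setting.** There are $n\ge 1$ arms and $J\ge 2$ hypotheses $\theta_1,\dots,\theta_J$. If $\theta$ is the true hypothesis, a pull of arm $i$ returns an independent Gaussian reward with mean $\mu_i(\theta)$ and variance $1/2$. A policy draws the arm $I_{t+1}$ from a law that depends on the past rounds $(I_1,Y_1,\dots,I_t,Y_t)$, stops at a stopping time $\tau$ of the filtration $\mathcal F_t=\sigma(I_1,Y_1,\dots,I_t,Y_t)$ and then predicts a hypothesis $\hat\theta$ that is $\mathcal F_\tau$-measurable. It is $\delta$-PAC if, for every true hypothesis $\theta\in\{\theta_1,\dots,\theta_J\}$, $\tau<\infty$ almost surely and $\mathbb P_\theta(\hat\theta\ne\theta)\le\delta$. **Environment.** Let $\Gamma>0$, let $\mu_1(\theta_j)=\Gamma-(j-1)\Gamma/J$ for $1\le j\le J$, and $\mu_i(\theta_j)=\epsilon_{ij}$ for $2\le i\le n$, where the $\epsilon_{ij}$ are pairwise distinct and $|\epsilon_{ij}|<\Gamma/(4J)$. **Algorithm.** Let $L_t(\theta)=\sum_{s\le t}(Y_s-\mu_{I_s}(\theta))^2$, let $\hat\theta(t)$ be a minimizer of $L_t$ (ties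 broken uniformly at random), and let $p_\theta$ be a probability vector that maximizes $\min_{\theta'\ne\theta}\sum_i p(i)(\mu_i(\theta')-\mu_i(\theta))^2$. Generalized Chernoff Sampling (GCS) draws $I_1$ uniformly and $I_{t+1}\sim p_{\hat\theta(t)}$ for $t\ge1$. It stops at the first $t\ge2$ with $L_t(\theta')-L_t(\hat\theta(t))>\log(J/\delta)$ for all $\theta'\ne\hat\theta(t)$, and returns $\hat\theta(t)$. **Theorem 4.** In this environment the following hold for every true hypothesis $\theta\in\{\theta_1,\dots,\theta_J\}$. 1. (Lower bound) For every $\delta_0<1/2$ there is a constant $c>0$, depending only on $\delta_0$, such that for all $0<\delta\le\delta_0$ every $\delta$-PAC policy satisfies $\mathbb E_\theta[\tau]\ge c\,J^2\Gamma^{-2}\log(1/\delta)$. 2. (Upper bound) Maximizers $p_\theta$ exist. There is a universal constant $C$ such that, for every choice of the maximizers $p_\theta$ and all $0<\delta<1$, GCS is $\delta$-PAC and its stopping time $\tau_\delta$ satisfies $\mathbb E_\theta[\tau_\delta]\le C\,(1+J^2\Gamma^{-2}\log(J/\delta))$; if moreover $\Gamma\le J$, then $\mathbb E_\theta[\tau_\delta]\le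 C\,J^2\Gamma^{-2}\log(J/\delta)$. 3. (Optimality up to constants) For every $\delta_0<1/2$ there is a constant $K$, depending only on $\delta_0$, such that for all $0<\delta\le\min(\delta_0,1/J)$ the expected number of samples of GCS under $\theta$ is at most $K$ times that of any $\delta$-PAC policy. -/

import Mathlib

open MeasureTheory ProbabilityTheory
open scoped NNReal ENNReal

noncomputable section

namespace ActiveTesting

/-- One round of interaction with `n` arms: the arm that is pulled and the reward it returns. -/
abbrev Round (n : ℕ) : Type := Fin n × ℝ

/-- The first `t` rounds `(I₁, Y₁), …, (I_t, Y_t)`; the entry with index `s : Fin t` is round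
`s + 1`. -/
abbrev History (n t : ℕ) : Type := Fin t → Round n

/-- The first `t` rounds of an infinite run. -/
def prefixOf {n : ℕ} (t : ℕ) (ω : ℕ → Round n) : History n t := fun s => ω s

/-- A sequential policy with `n` arms and `J` hypotheses. After `t` rounds it draws the next arm
from a probability law that depends only on the history; whether it has stopped after `t` rounds
and which hypothesis it would then predict are functions of the history as well.
(A stopping time of the filtration generated by the rounds, together with a prediction that is
measurable at that time, is the same thing as such a pair `haltSet`, `predict`.) -/
structure Policy (n J : ℕ) where
  /-- law of arm `I_{t+1}` given the first `t` rounds -/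
  sample : (t : ℕ) → Kernel (History n t) (Fin n)
  isMarkov : ∀ t, IsMarkovKernel (sample t)
  /-- histories of length `t` at which the policy stops, unless it has stopped before -/
  haltSet : (t : ℕ) → Set (History n t)
  measurableSet_haltSet : ∀ t, MeasurableSet (haltSet t)
  /-- the hypothesis predicted when the policy stops after `t` rounds -/
  predict : (t : ℕ) → History n t → Fin J
  measurable_predict : ∀ t, Measurable (predict t)

attribute [instance] Policy.isMarkov

/-- Rewards when `θ` is the true hypothesis: arm `i` returns a Gaussian variable with mean
`μ i θ` and variance `1/2`. -/
def rewardKernel {n J : ℕ} (μ : Fin n → Fin J → ℝ) (θ : Fin J) : Kernel (Fin n) ℝ :=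
  Kernel.ofFunOfCountable fun i => gaussianReal (μ i θ) (1 / 2)

instance {n J : ℕ} (μ : Fin n → Fin J → ℝ) (θ : Fin J) : IsMarkovKernel (rewardKernel μ θ) :=
  ⟨fun i => inferInstanceAs (IsProbabilityMeasure (gaussianReal (μ i θ) (1 / 2)))⟩

namespace Policy

variable {n J : ℕ} (π : Policy n J)

/-- Law of round `t + 1` given the first `t` rounds, when `θ` is the true hypothesis: the policy
draws the arm, and the environment draws the reward of that arm. -/
def step (μ : Fin n → Fin J → ℝ) (θ : Fin J) (t : ℕ) : Kernel (History n t) (Round n) :=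
  π.sample t ⊗ₖ Kernel.prodMkLeft (History n t) (rewardKernel μ θ)

instance (μ : Fin n → Fin J → ℝ) (θ : Fin J) (t : ℕ) : IsMarkovKernel (π.step μ θ t) := by
  unfold step; infer_instance

/-- Read a family indexed by `0, …, t` as a history of length `t + 1`. -/
def toHistory (n t : ℕ) (h : (i : Finset.Iic t) → Round n) : History n (t + 1) :=
  fun s => h ⟨s, Finset.mem_Iic.2 (Nat.le_of_lt_succ s.2)⟩

theorem measurable_toHistory (n t : ℕ) : Measurable (toHistory n t) :=
  measurable_pi_lambda _ fun _ => measurable_pi_apply _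

/-- The law `ℙ_θ` of the infinite run of rounds that the sampling rule of the policy generates
when `θ` is the true hypothesis. -/
def law (μ : Fin n → Fin J → ℝ) (θ : Fin J) : Measure (ℕ → Round n) :=
  Kernel.trajMeasure (X := fun _ => Round n) (π.step μ θ 0 Fin.elim0)
    fun t => (π.step μ θ (t + 1)).comap (toHistory n t) (measurable_toHistory n t)

/-- The stopping time `τ`: the number of rounds observed when the policy stops. -/
def stopTime (ω : ℕ → Round n) : ℕ∞ :=
  ⨅ (t : ℕ) (_ : prefixOf t ω ∈ π.haltSet t), (t : ℕ∞)

/-- The expected number of samples `𝔼_θ[τ]`. -/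
def expectedTime (μ : Fin n → Fin J → ℝ) (θ : Fin J) : ℝ≥0∞ :=
  ∫⁻ ω, ((π.stopTime ω : ℕ∞) : ℝ≥0∞) ∂(π.law μ θ)

/-- The policy is `δ`-PAC: whichever hypothesis `θ` is true, it stops almost surely, and its
prediction differs from `θ` with probability at most `δ`. -/
def IsDeltaPAC (μ : Fin n → Fin J → ℝ) (δ : ℝ) : Prop :=
  ∀ θ : Fin J, (∀ᵐ ω ∂(π.law μ θ), π.stopTime ω ≠ ⊤) ∧
    π.law μ θ {ω | ∃ t : ℕ, π.stopTime ω = t ∧ π.predict t (prefixOf t ω) ≠ θ}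
      ≤ ENNReal.ofReal δ

end Policy

/-- The sum of squared errors `L(θ) = ∑ₛ (Yₛ - μ_{Iₛ}(θ))²`. -/
def sqErr {n J t : ℕ} (μ : Fin n → Fin J → ℝ) (h : History n t) (θ : Fin J) : ℝ :=
  ∑ s, ((h s).2 - μ (h s).1 θ) ^ 2

/-- The hypotheses of smallest sum of squared errors. -/
def bestFit {n J t : ℕ} (μ : Fin n → Fin J → ℝ) (h : History n t) : Set (Fin J) :=
  {θ | ∀ θ', sqErr μ h θ ≤ sqErr μ h θ'}

/-- The value at `q` of the max-min problem of verifying `θ`: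
`min_{θ' ≠ θ} ∑ᵢ q(i) (μᵢ(θ') - μᵢ(θ))²`. -/
def verifValue {n J : ℕ} (μ : Fin n → Fin J → ℝ) (θ : Fin J) (q : PMF (Fin n)) : ℝ :=
  ⨅ θ' : {θ' : Fin J // θ' ≠ θ}, ∑ i, (q i).toReal * (μ i θ' - μ i θ) ^ 2

/-- `q` is a verification proportion for `θ`: a maximizer of the max-min problem. -/
def IsVerifProportion {n J : ℕ} (μ : Fin n → Fin J → ℝ) (θ : Fin J) (q : PMF (Fin n)) : Prop :=
  ∀ q' : PMF (Fin n), verifValue μ θ q' ≤ verifValue μ θ q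

theorem measurable_sqErr {n J t : ℕ} (μ : Fin n → Fin J → ℝ) (θ : Fin J) :
    Measurable fun h : History n t => sqErr μ h θ := by
  unfold sqErr
  refine Finset.measurable_sum _ fun s _ => ?_
  have h1 : Measurable fun h : History n t => (h s).2 := by fun_prop
  have h2 : Measurable fun h : History n t => μ (h s).1 θ :=
    (measurable_of_countable fun i => μ i θ).comp
      (measurable_fst.comp (measurable_pi_apply s))
  exact (h1.sub h2).pow_const 2

theorem measurable_bestFit {n J t : ℕ} (μ : Fin n → Fin J → ℝ) :
    Measurable (bestFit μ : History n t → Set (Fin J)) := by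
  refine measurable_set_iff.2 fun θ => ?_
  refine measurable_to_prop ?_
  have : ((fun h : History n t => θ ∈ bestFit μ h) ⁻¹' {True})
      = ⋂ θ', {h | sqErr μ h θ ≤ sqErr μ h θ'} := by
    ext h; simp [bestFit]
  rw [this]
  exact MeasurableSet.iInter fun θ' =>
    measurableSet_le (measurable_sqErr μ θ) (measurable_sqErr μ θ')

theorem bestFit_nonempty {n J t : ℕ} [NeZero J] (μ : Fin n → Fin J → ℝ) (h : History n t) :
    (bestFit μ h).Nonempty :=
  Finite.exists_min (sqErr μ h)

/-- The estimate `θ̂` after `t` rounds: uniformly random among the hypotheses of smallest sum of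
squared errors. -/
def estimate {n J : ℕ} (μ : Fin n → Fin J → ℝ) (t : ℕ) : Kernel (History n t) (Fin J) :=
  (Kernel.ofFunOfCountable fun S : Set (Fin J) => uniformOn S).comap (bestFit μ)
    (measurable_bestFit μ)

instance {n J : ℕ} [NeZero J] (μ : Fin n → Fin J → ℝ) (t : ℕ) :
    IsMarkovKernel (estimate μ t) :=
  ⟨fun h => isProbabilityMeasure_uniformOn (Set.toFinite _) (bestFit_nonempty μ h)⟩

/-- An arm drawn from the proportion `p θ` that belongs to `θ`. -/
def armKernel {n J : ℕ} (p : Fin J → PMF (Fin n)) : Kernel (Fin J) (Fin n) :=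
  Kernel.ofFunOfCountable fun θ => (p θ).toMeasure

instance {n J : ℕ} (p : Fin J → PMF (Fin n)) : IsMarkovKernel (armKernel p) :=
  ⟨fun θ => inferInstanceAs (IsProbabilityMeasure (p θ).toMeasure)⟩

/-- Sampling rule of Generalized Chernoff Sampling: the first arm is uniformly random; later, draw
the estimate `θ̂` from the history and then the arm from `p θ̂`. -/
def gcsSample {n J : ℕ} [NeZero n] (μ : Fin n → Fin J → ℝ) (p : Fin J → PMF (Fin n)) :
    (t : ℕ) → Kernel (History n t) (Fin n)
  | 0 => Kernel.const _ (uniformOn Set.univ)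
  | t + 1 => armKernel p ∘ₖ estimate μ (t + 1)

/-- Generalized Chernoff Sampling stops after the first round `t ≥ 2` at which the sum of squared
errors of each competitor exceeds that of the estimate by more than `log (J / δ)`. -/
def gcsStop {n J : ℕ} (μ : Fin n → Fin J → ℝ) (δ : ℝ) (t : ℕ) : Set (History n t) :=
  {h | 2 ≤ t ∧ ∃ θ ∈ bestFit μ h, ∀ θ', θ' ≠ θ →
    sqErr μ h θ' - sqErr μ h θ > Real.log (J / δ)}

/-- Generalized Chernoff Sampling with verification proportions `p` and confidence `δ`. It returns
a hypothesis of smallest sum of squared errors, which is unique when it stops, the threshold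
`log (J / δ)` being positive. -/
def gcs {n J : ℕ} [NeZero n] [NeZero J] (μ : Fin n → Fin J → ℝ) (p : Fin J → PMF (Fin n))
    (δ : ℝ) : Policy n J where
  sample := gcsSample μ p
  isMarkov t := by
    cases t with
    | zero =>
      have : IsProbabilityMeasure (uniformOn (Set.univ : Set (Fin n))) :=
        isProbabilityMeasure_uniformOn Set.finite_univ Set.univ_nonempty
      unfold gcsSample; infer_instance
    | succ t => unfold gcsSample; infer_instance
  haltSet := gcsStop μ δ
  measurableSet_haltSet t := by
    have : (gcsStop μ δ t : Set (History n t)) = {_h | 2 ≤ t} ∩ ⋃ θ : Fin J,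
        (⋂ θ' : Fin J, {h | sqErr μ h θ ≤ sqErr μ h θ'}) ∩
        ⋂ θ' : Fin J, ⋂ _ : θ' ≠ θ, {h | Real.log (J / δ) < sqErr μ h θ' - sqErr μ h θ} := by
      ext h; simp [gcsStop, bestFit]
    rw [this]
    refine MeasurableSet.inter (MeasurableSet.const _) (MeasurableSet.iUnion fun θ => ?_)
    refine MeasurableSet.inter (MeasurableSet.iInter fun θ' =>
      measurableSet_le (measurable_sqErr μ θ) (measurable_sqErr μ θ')) ?_
    exact MeasurableSet.iInter fun θ' => MeasurableSet.iInter fun _ =>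
      measurableSet_lt measurable_const ((measurable_sqErr μ θ').sub (measurable_sqErr μ θ))
  predict t h := (bestFit_nonempty μ h).some
  measurable_predict t := by
    classical
    let g : Set (Fin J) → Fin J := fun S => if hS : S.Nonempty then hS.some else 0
    have hg : (fun h : History n t => (bestFit_nonempty μ h).some) = g ∘ bestFit μ := by
      funext h; simp [g, bestFit_nonempty μ h]
    rw [hg]
    exact (measurable_of_countable g).comp (measurable_bestFit μ)

/-- The environment with `n` arms and `J` hypotheses, indexed from `0`: under hypothesis `j` the
arm `0` has mean `Γ - j Γ / J`, and the means of the other arms under the hypotheses are pairwise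
distinct numbers of absolute value less than `Γ / (4 J)`. -/
structure IsHardEnv {n J : ℕ} [NeZero n] (Γ : ℝ) (μ : Fin n → Fin J → ℝ) : Prop where
  first_arm : ∀ j : Fin J, μ 0 j = Γ - j * Γ / J
  small : ∀ i : Fin n, i ≠ 0 → ∀ j : Fin J, |μ i j| < Γ / (4 * J)
  distinct : ∀ i : Fin n, i ≠ 0 → ∀ i' : Fin n, i' ≠ 0 → ∀ j j' : Fin J,
    μ i j = μ i' j' → i = i' ∧ j = j'

end ActiveTesting

end

noncomputable section

namespace ActiveTesting

/-! ### Gaussian rewards -/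

/-! Arm `0` separates every pair of hypotheses by at least Γ/J, while any other arm separates them
by strictly less than that. Pulling only arm `0` is therefore the unique verification proportion for
every hypothesis (`IsHardEnv.eq_pure`), and GCS pulls arm `0` from round 2 on, whatever its estimate
is. At the same time adjacent hypotheses differ by exactly Γ/J on arm `0`, so no arm tells them
apart faster.

With variance 1/2, differences of squared errors are exactly log-likelihood ratios, and both bounds
rest on their exponential moments, which multiply round by round. Lower bound: against an adjacent
hypothesis the second moment of the likelihood ratio is at most exp(2(Γ/J)²T) after T rounds. By a
chi-square argument (`two_point_bound`), an event of probability at least 1/2 under θ and at most δ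
under its neighbor needs T of order J²Γ⁻² log(1/δ); Markov's inequality passes from T to the
expectation. Upper bound: the moment of order -1/2 decays like exp(-t(Γ/J)²/4), so not having
stopped becomes exponentially unlikely (`law_notMem_gcsStop_le`). Correctness is a change of measure
on the event of a wrong decision (`gcs_error_le`). Optimality compares the two bounds; the additive
constant is absorbed because every δ-PAC policy takes a sample (`one_le_expectedTime`). -/

theorem gaussianReal_eq_withDensity (a b : ℝ) :
    gaussianReal b (1 / 2) = (gaussianReal a (1 / 2)).withDensity
      fun y => ENNReal.ofReal (Real.exp ((y - a) ^ 2 - (y - b) ^ 2)) := by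
  have hv : (1 / 2 : ℝ≥0) ≠ 0 := by norm_num
  rw [gaussianReal_of_var_ne_zero _ hv, gaussianReal_of_var_ne_zero _ hv,
    ← withDensity_mul _ (measurable_gaussianPDF _ _) (by fun_prop)]
  congr 1
  ext y
  rw [Pi.mul_apply, gaussianPDF, gaussianPDF, ← ENNReal.ofReal_mul (gaussianPDFReal_nonneg _ _ _),
    gaussianPDFReal, gaussianPDFReal, mul_assoc _ (Real.exp _), ← Real.exp_add]
  congr 3
  push_cast
  ring

/-- The squares in y cancel, leaving a Gaussian moment generating function. Two values matter: c = 1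
gives the factor 2 of the chi-square bound, and c = -1/2, the minimizer of c + c², gives the decay
rate 1/4. -/
theorem lintegral_gaussianReal_exp_mul (a b c : ℝ) :
    ∫⁻ y, ENNReal.ofReal (Real.exp (c * ((y - b) ^ 2 - (y - a) ^ 2)))
        ∂gaussianReal a (1 / 2)
      = ENNReal.ofReal (Real.exp ((c + c ^ 2) * (b - a) ^ 2)) := by
  have hint := (integrable_exp_mul_gaussianReal (μ := a) (v := 1 / 2) (2 * c * (a - b)))
  have hmgf := congrFun (mgf_id_gaussianReal (μ := a) (v := 1 / 2)) (2 * c * (a - b))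
  rw [mgf] at hmgf
  simp only [id] at hmgf
  have h : ∀ y : ℝ, Real.exp (c * ((y - b) ^ 2 - (y - a) ^ 2))
      = Real.exp (c * (b ^ 2 - a ^ 2)) * Real.exp (2 * c * (a - b) * y) := by
    intro y
    rw [← Real.exp_add]
    congr 1
    ring
  simp_rw [h]
  rw [← ofReal_integral_eq_lintegral_ofReal (hint.const_mul _)
    (Filter.Eventually.of_forall fun y => by positivity), integral_const_mul, hmgf, ← Real.exp_add]
  congr 2
  push_cast
  ring

/-! ### One round of a run -/

theorem measurable_prefixOf {n : ℕ} (t : ℕ) :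
    Measurable (prefixOf t : (ℕ → Round n) → History n t) :=
  measurable_pi_lambda _ fun s => measurable_pi_apply (s : ℕ)

/-- A history followed by one more round. -/
def extend {n t : ℕ} (h : History n t) (r : Round n) : History n (t + 1) :=
  Fin.snoc (α := fun _ => Round n) h r

theorem prefixOf_succ {n : ℕ} (t : ℕ) (ω : ℕ → Round n) :
    prefixOf (t + 1) ω = extend (prefixOf t ω) (ω t) := by
  funext s
  refine Fin.lastCases ?_ (fun s => ?_) s
  · simp [prefixOf, extend]
  · simp [prefixOf, extend]

theorem sqErr_extend {n J t : ℕ} (μ : Fin n → Fin J → ℝ) (h : History n t) (r : Round n)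
    (θ : Fin J) :
    sqErr μ (extend h r) θ
      = sqErr μ h θ + (r.2 - μ r.1 θ) ^ 2 := by
  simp [sqErr, extend, Fin.sum_univ_castSucc]

theorem sqErr_zero {n J : ℕ} (μ : Fin n → Fin J → ℝ) (h : History n 0) (θ : Fin J) :
    sqErr μ h θ = 0 := by
  simp [sqErr]

/-- The log-likelihood ratio of `θ` against `θ'`. -/
def logLik {n J t : ℕ} (μ : Fin n → Fin J → ℝ) (θ θ' : Fin J)
    (h : History n t) : ℝ :=
  sqErr μ h θ' - sqErr μ h θ

@[fun_prop]
theorem measurable_logLik {n J t : ℕ} (μ : Fin n → Fin J → ℝ)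
    (θ θ' : Fin J) : Measurable (logLik μ θ θ' : History n t → ℝ) :=
  (measurable_sqErr μ θ').sub (measurable_sqErr μ θ)

theorem logLik_extend {n J t : ℕ} (μ : Fin n → Fin J → ℝ)
    (θ θ' : Fin J) (h : History n t) (r : Round n) :
    logLik μ θ θ' (extend h r)
      = logLik μ θ θ' h + ((r.2 - μ r.1 θ') ^ 2 - (r.2 - μ r.1 θ) ^ 2) := by
  simp only [logLik, sqErr_extend]
  ring

theorem measurable_extend {n : ℕ} (t : ℕ) : Measurable fun x : History n t × Round n =>
    extend x.1 x.2 := by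
  refine measurable_pi_lambda _ fun s => ?_
  refine Fin.lastCases ?_ (fun s => ?_) s
  · simpa [extend] using measurable_snd
  · simp only [extend, Fin.snoc_castSucc]
    exact (measurable_pi_apply s).comp measurable_fst

theorem measurable_mean {n J : ℕ} (μ : Fin n → Fin J → ℝ) (θ : Fin J) :
    Measurable fun r : Round n => μ r.1 θ :=
  (measurable_of_countable fun i => μ i θ).comp measurable_fst

namespace Policy

variable {n J : ℕ} (π : Policy n J) (μ : Fin n → Fin J → ℝ)

instance (θ : Fin J) : IsProbabilityMeasure (π.law μ θ) := by
  unfold law; infer_instance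

theorem map_law_zero (θ : Fin J) :
    (π.law μ θ).map (fun ω => ω 0) = π.step μ θ 0 Fin.elim0 := by
  have h : (fun ω : ℕ → Round n => ω 0)
      = (fun x : (i : Finset.Iic 0) → Round n => x ⟨0, by simp⟩) ∘ Preorder.frestrictLe 0 := rfl
  rw [h, ← Measure.map_map (by fun_prop) (by fun_prop), law, Kernel.trajMeasure,
    Measure.map_comp _ _ (by fun_prop), Kernel.traj_map_frestrictLe, Kernel.partialTraj_self,
    Measure.id_comp, Measure.map_map (by fun_prop) (by fun_prop)]
  exact Measure.map_id

/-- The tower property for one round. Together with `map_law_zero` it isolates the trajectory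
construction; the inductions over rounds below use only this form. -/
theorem lintegral_law_succ (θ : Fin J) (t : ℕ) {f : History n t → Round n → ℝ≥0∞}
    (hf : Measurable (Function.uncurry f)) :
    ∫⁻ ω, f (prefixOf t ω) (ω t) ∂π.law μ θ
      = ∫⁻ ω, ∫⁻ r, f (prefixOf t ω) r ∂π.step μ θ t (prefixOf t ω) ∂π.law μ θ := by
  cases t with
  | zero =>
    have he : ∀ ω : ℕ → Round n, prefixOf 0 ω = Fin.elim0 := fun ω => Subsingleton.elim _ _
    simp_rw [he]
    rw [lintegral_const, measure_univ, mul_one, ← π.map_law_zero μ θ,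
      lintegral_map (hf.of_uncurry_left) (by fun_prop)]
  | succ t =>
    have key := Kernel.map_frestrictLe_trajMeasure_compProd_eq_map_trajMeasure
      (X := fun _ => Round n) (μ₀ := π.step μ θ 0 Fin.elim0)
      (κ := fun t => (π.step μ θ (t + 1)).comap (toHistory n t) (measurable_toHistory n t))
      (a := t)
    let F : ((i : Finset.Iic t) → Round n) × Round n → ℝ≥0∞ :=
      fun x => f (toHistory n t x.1) x.2
    have hF : Measurable F :=
      hf.comp (((measurable_toHistory n t).comp measurable_fst).prodMk measurable_snd)
    have h1 := congrArg (fun m => ∫⁻ x, F x ∂m) key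
    rw [lintegral_map hF (by fun_prop), Measure.lintegral_compProd hF,
      lintegral_map hF.lintegral_kernel_prod_right' (by fun_prop)] at h1
    exact h1.symm

theorem lintegral_step (θ : Fin J) (t : ℕ) (h : History n t) {f : Round n → ℝ≥0∞}
    (hf : Measurable f) :
    ∫⁻ r, f r ∂π.step μ θ t h
      = ∫⁻ i, ∫⁻ y, f (i, y) ∂gaussianReal (μ i θ) (1 / 2) ∂π.sample t h := by
  rw [step, Kernel.lintegral_compProd _ _ _ hf]
  rfl

/-! ### Likelihood ratios -/

/-- Change of measure for the first `t` rounds. -/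
theorem lintegral_law_change (θ θ' : Fin J) (t : ℕ) {F : History n t → ℝ≥0∞}
    (hF : Measurable F) :
    ∫⁻ ω, F (prefixOf t ω) ∂π.law μ θ'
      = ∫⁻ ω, F (prefixOf t ω) * ENNReal.ofReal (Real.exp (-logLik μ θ θ' (prefixOf t ω)))
          ∂π.law μ θ := by
  induction t with
  | zero =>
    have he : ∀ ω : ℕ → Round n, prefixOf 0 ω = Fin.elim0 := fun ω => Subsingleton.elim _ _
    simp [he, logLik, sqErr_zero]
  | succ t ih =>
    have m1 := measurable_mean (n := n) μ θ
    have m2 := measurable_mean (n := n) μ θ'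
    have hFs := hF.comp (measurable_extend (n := n) t)
    have hw : Measurable fun r : Round n =>
        ENNReal.ofReal (Real.exp ((r.2 - μ r.1 θ) ^ 2 - (r.2 - μ r.1 θ') ^ 2)) := by fun_prop
    let G : History n t → ℝ≥0∞ := fun h => ∫⁻ r, F (extend h r)
      ∂π.step μ θ' t h
    have hG : Measurable G := Measurable.lintegral_kernel_prod_right' hFs
    have hGeq : ∀ h, G h = ∫⁻ r, F (extend h r) *
        ENNReal.ofReal (Real.exp ((r.2 - μ r.1 θ) ^ 2 - (r.2 - μ r.1 θ') ^ 2))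
          ∂π.step μ θ t h := by
      intro h
      have hFh : Measurable fun r => F (extend h r) :=
        hFs.comp measurable_prodMk_left
      simp only [G]
      rw [lintegral_step _ _ _ _ _ hFh, lintegral_step _ _ _ _ _
        (f := fun r => F (extend h r) * _) (hFh.mul hw)]
      refine lintegral_congr fun i => ?_
      -- The law of the arm given the history is the same under both hypotheses, so only the reward
      -- density enters the ratio.
      rw [gaussianReal_eq_withDensity (μ i θ) (μ i θ'),
        lintegral_withDensity_eq_lintegral_mul _ (by fun_prop)
          (g := fun y => F (extend h (i, y))) (hFh.comp measurable_prodMk_left)]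
      refine lintegral_congr fun y => ?_
      rw [Pi.mul_apply, mul_comm]
    simp_rw [prefixOf_succ]
    rw [π.lintegral_law_succ μ θ' t
      (f := fun h r => F (extend h r)) hFs]
    rw [π.lintegral_law_succ μ θ t
      (f := fun h r => F (extend h r) * ENNReal.ofReal
        (Real.exp (-logLik μ θ θ' (extend h r))))
      (hFs.mul ((by fun_prop : Measurable fun h : History n (t + 1) =>
        ENNReal.ofReal (Real.exp (-logLik μ θ θ' h))).comp (measurable_extend (n := n) t)))]
    rw [show (fun ω : ℕ → Round n => ∫⁻ r, F (extend (prefixOf t ω) r)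
      ∂π.step μ θ' t (prefixOf t ω)) = fun ω => G (prefixOf t ω) from rfl, ih hG]
    refine lintegral_congr fun ω => ?_
    rw [hGeq, ← lintegral_mul_const _
      (f := fun r => F (extend _ r) * _) ((hFs.comp measurable_prodMk_left).mul hw)]
    refine lintegral_congr fun r => ?_
    rw [mul_assoc, ← ENNReal.ofReal_mul (Real.exp_pos _).le, ← Real.exp_add, logLik_extend]
    congr 4
    ring

/-- Exponential moments of the log-likelihood ratio after one more round. -/
theorem lintegral_exp_logLik_succ_le (θ θ' : Fin J) (c : ℝ) (t : ℕ) {b : ℝ≥0∞}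
    (hb : ∀ h, ∫⁻ i, ENNReal.ofReal (Real.exp ((c + c ^ 2) * (μ i θ' - μ i θ) ^ 2))
      ∂π.sample t h ≤ b) :
    ∫⁻ ω, ENNReal.ofReal (Real.exp (c * logLik μ θ θ' (prefixOf (t + 1) ω))) ∂π.law μ θ
      ≤ (∫⁻ ω, ENNReal.ofReal (Real.exp (c * logLik μ θ θ' (prefixOf t ω))) ∂π.law μ θ) * b := by
  have m1 := measurable_mean (n := n) μ θ
  have m2 := measurable_mean (n := n) μ θ'
  have mp := measurable_prefixOf (n := n) t
  let E (t : ℕ) (h : History n t) : ℝ≥0∞ := ENNReal.ofReal (Real.exp (c * logLik μ θ θ' h))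
  have hE (t : ℕ) : Measurable (E t) := by fun_prop
  let w (r : Round n) : ℝ≥0∞ :=
    ENNReal.ofReal (Real.exp (c * ((r.2 - μ r.1 θ') ^ 2 - (r.2 - μ r.1 θ) ^ 2)))
  have hw : Measurable w := by fun_prop
  have hmul (h : History n t) (r : Round n) : E (t + 1) (extend h r) = E t h * w r := by
    simp only [E, w]
    rw [← ENNReal.ofReal_mul (Real.exp_pos _).le, ← Real.exp_add, logLik_extend, mul_add]
  change ∫⁻ ω, E (t + 1) (prefixOf (t + 1) ω) ∂π.law μ θ
    ≤ (∫⁻ ω, E t (prefixOf t ω) ∂π.law μ θ) * b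
  simp_rw [prefixOf_succ, hmul]
  rw [π.lintegral_law_succ μ θ t (f := fun h r => E t h * w r)
    (((hE t).comp measurable_fst).mul (hw.comp measurable_snd)),
    ← lintegral_mul_const _ (f := fun ω => E t (prefixOf t ω)) ((hE t).comp mp)]
  refine lintegral_mono fun ω => ?_
  simp only
  rw [lintegral_const_mul _ hw]
  gcongr
  rw [lintegral_step _ _ _ _ _ hw]
  simp only [w, lintegral_gaussianReal_exp_mul]
  exact hb (prefixOf t ω)

theorem lintegral_exp_logLik_zero (θ θ' : Fin J) (c : ℝ) :
    ∫⁻ ω, ENNReal.ofReal (Real.exp (c * logLik μ θ θ' (prefixOf 0 ω))) ∂π.law μ θ = 1 := by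
  simp [logLik, sqErr_zero]

end Policy

/-! ### Stopping and deciding -/

/-- The first `s` rounds of a history. -/
def truncate {n s t : ℕ} (hst : s ≤ t) (h : History n t) : History n s :=
  fun i => h (Fin.castLE hst i)

theorem measurable_truncate {n s t : ℕ} (hst : s ≤ t) :
    Measurable (truncate hst : History n t → History n s) :=
  measurable_pi_lambda _ fun _ => measurable_pi_apply _

theorem truncate_prefixOf {n s t : ℕ} (hst : s ≤ t) (ω : ℕ → Round n) :
    truncate hst (prefixOf t ω) = prefixOf s ω := rfl

namespace Policy

variable {n J : ℕ} (π : Policy n J) (μ : Fin n → Fin J → ℝ)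

theorem stopTime_le {ω : ℕ → Round n} {t : ℕ} (h : prefixOf t ω ∈ π.haltSet t) :
    π.stopTime ω ≤ t :=
  iInf₂_le t h

theorem le_stopTime {ω : ℕ → Round n} {t : ℕ} (h : ∀ s < t, prefixOf s ω ∉ π.haltSet s) :
    (t : ℕ∞) ≤ π.stopTime ω :=
  le_iInf₂ fun s hs => Nat.cast_le.2 (not_lt.1 fun hst => h s hst hs)

theorem stopTime_eq_iff (ω : ℕ → Round n) (t : ℕ) :
    π.stopTime ω = t ↔
      prefixOf t ω ∈ π.haltSet t ∧ ∀ s < t, prefixOf s ω ∉ π.haltSet s := by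
  refine ⟨fun h => ?_, fun h => le_antisymm (π.stopTime_le h.1) (π.le_stopTime h.2)⟩
  have h2 : ∀ s < t, prefixOf s ω ∉ π.haltSet s := fun s hs hh => by
    have := π.stopTime_le hh
    rw [h, Nat.cast_le] at this
    omega
  refine ⟨by_contra fun h1 => ?_, h2⟩
  have h3 : ((t + 1 : ℕ) : ℕ∞) ≤ π.stopTime ω := π.le_stopTime fun s hs => by
    rcases Nat.lt_succ_iff_lt_or_eq.1 hs with hs | rfl
    · exact h2 s hs
    · exact h1
  rw [h, Nat.cast_le] at h3
  omega

/-- Histories of length `t` after which the policy stops, not having stopped before, and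
predicts `θ`. -/
def decisionSet (t : ℕ) (θ : Fin J) : Set (History n t) :=
  {h | h ∈ π.haltSet t ∧ (∀ s, ∀ hs : s < t, truncate hs.le h ∉ π.haltSet s) ∧
    π.predict t h = θ}

theorem measurableSet_decisionSet (t : ℕ) (θ : Fin J) :
    MeasurableSet (π.decisionSet t θ) := by
  have h : π.decisionSet t θ = π.haltSet t ∩
      ((⋂ s, ⋂ hs : s < t, (truncate hs.le ⁻¹' π.haltSet s)ᶜ) ∩ π.predict t ⁻¹' {θ}) := by
    ext h; simp [decisionSet]; tauto
  rw [h]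
  exact (π.measurableSet_haltSet t).inter ((MeasurableSet.iInter fun s => MeasurableSet.iInter
    fun hs => (measurable_truncate hs.le (π.measurableSet_haltSet s)).compl).inter
      (π.measurable_predict t (measurableSet_singleton θ)))

theorem prefixOf_mem_decisionSet (t : ℕ) (θ : Fin J) (ω : ℕ → Round n) :
    prefixOf t ω ∈ π.decisionSet t θ ↔
      π.stopTime ω = t ∧ π.predict t (prefixOf t ω) = θ := by
  rw [stopTime_eq_iff, and_assoc]
  rfl

/-- Histories of length `T` in which the policy has stopped and predicted `θ`. -/
def decidedSet (T : ℕ) (θ : Fin J) : Set (History n T) :=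
  ⋃ t, ⋃ ht : t ≤ T, truncate ht ⁻¹' π.decisionSet t θ

theorem measurableSet_decidedSet (T : ℕ) (θ : Fin J) : MeasurableSet (π.decidedSet T θ) :=
  MeasurableSet.iUnion fun _ => MeasurableSet.iUnion fun ht =>
    measurable_truncate ht (π.measurableSet_decisionSet _ θ)

theorem prefixOf_mem_decidedSet (T : ℕ) (θ : Fin J) (ω : ℕ → Round n) :
    prefixOf T ω ∈ π.decidedSet T θ ↔
      ∃ t ≤ T, π.stopTime ω = t ∧ π.predict t (prefixOf t ω) = θ := by
  simp only [decidedSet, Set.mem_iUnion, Set.mem_preimage, truncate_prefixOf,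
    prefixOf_mem_decisionSet, exists_prop]

/-- Markov's inequality for the stopping time. -/
theorem mul_law_notHalted_le (θ : Fin J) (T : ℕ) :
    (T + 1 : ℕ) * π.law μ θ {ω | ∀ t ≤ T, prefixOf t ω ∉ π.haltSet t}
      ≤ π.expectedTime μ θ := by
  have hm : MeasurableSet {ω : ℕ → Round n | ∀ t ≤ T, prefixOf t ω ∉ π.haltSet t} := by
    have h : {ω : ℕ → Round n | ∀ t ≤ T, prefixOf t ω ∉ π.haltSet t}
        = ⋂ t, ⋂ _ : t ≤ T, (prefixOf t ⁻¹' π.haltSet t)ᶜ := by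
      ext ω; simp
    rw [h]
    exact MeasurableSet.iInter fun t => MeasurableSet.iInter fun _ =>
      (measurable_prefixOf t (π.measurableSet_haltSet t)).compl
  rw [← lintegral_indicator_const hm]
  refine lintegral_mono fun ω => ?_
  by_cases hω : ω ∈ {ω : ℕ → Round n | ∀ t ≤ T, prefixOf t ω ∉ π.haltSet t}
  · rw [Set.indicator_of_mem hω]
    have := ENat.toENNReal_le.2 (π.le_stopTime (t := T + 1) fun s hs => hω s (by omega))
    simpa using this
  · rw [Set.indicator_of_notMem hω]
    exact zero_le

/-! ### A lower bound on the number of samples -/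

/-- Each round multiplies the moment by at most exp(2d) whichever arm is drawn, so adaptive sampling
cannot make it grow faster. -/
theorem lintegral_exp_logLik_le (θ θ' : Fin J) {d : ℝ}
    (hd : ∀ i, (μ i θ' - μ i θ) ^ 2 ≤ d) (T : ℕ) :
    ∫⁻ ω, ENNReal.ofReal (Real.exp (1 * logLik μ θ θ' (prefixOf T ω))) ∂π.law μ θ
      ≤ ENNReal.ofReal (Real.exp (2 * d * T)) := by
  induction T with
  | zero => rw [lintegral_exp_logLik_zero]; simp
  | succ T ih =>
    refine (π.lintegral_exp_logLik_succ_le μ θ θ' 1 T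
      (b := ENNReal.ofReal (Real.exp (2 * d))) fun h => ?_).trans ?_
    · calc ∫⁻ i, ENNReal.ofReal (Real.exp ((1 + 1 ^ 2) * (μ i θ' - μ i θ) ^ 2)) ∂π.sample T h
          ≤ ∫⁻ _, ENNReal.ofReal (Real.exp (2 * d)) ∂π.sample T h := by
            refine lintegral_mono fun i => ENNReal.ofReal_le_ofReal (Real.exp_le_exp.2 ?_)
            have := hd i
            linarith
        _ = _ := by simp
    · refine (mul_le_mul_left ih _).trans (le_of_eq ?_)
      rw [← ENNReal.ofReal_mul (Real.exp_pos _).le, ← Real.exp_add]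
      congr 2
      push_cast
      ring

theorem lintegral_ofReal_add_indicator {Ω : Type*} [MeasurableSpace Ω] (P : Measure Ω)
    [IsProbabilityMeasure P] {A : Set Ω} (hA : MeasurableSet A) {x y : ℝ} (hx : 0 ≤ x)
    (hy : 0 ≤ y) :
    ∫⁻ ω, ENNReal.ofReal (x + A.indicator (fun _ => y) ω) ∂P
      = ENNReal.ofReal (x + y * P.real A) := by
  rw [← ofReal_integral_eq_lintegral_ofReal (f := fun ω => x + A.indicator (fun _ => y) ω)
    ((integrable_const x).add ((integrable_const y).indicator hA))
    (Filter.Eventually.of_forall fun ω => add_nonneg hx (Set.indicator_nonneg (fun _ _ => hy) ω)),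
    integral_add (integrable_const x) ((integrable_const y).indicator hA),
    integral_indicator_const _ hA]
  simp [mul_comm]

/-- The chi-square bound for the probabilities of an event of the first `T` rounds under two
hypotheses, in its dual form. -/
theorem two_point_bound (θ θ' : Fin J) {d : ℝ} (hd : ∀ i, (μ i θ' - μ i θ) ^ 2 ≤ d) (T : ℕ)
    {B : Set (History n T)} (hB : MeasurableSet B) {a : ℝ} (ha : 1 ≤ a) :
    2 + (2 * a - 2) * (π.law μ θ).real (prefixOf T ⁻¹' B)
      ≤ Real.exp (2 * d * T) + (1 + (a ^ 2 - 1) * (π.law μ θ').real (prefixOf T ⁻¹' B)) := by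
  have hA : MeasurableSet (prefixOf T ⁻¹' B) := measurable_prefixOf T hB
  have ha2 : 0 ≤ a ^ 2 - 1 := by nlinarith
  have h1 := lintegral_ofReal_add_indicator (π.law μ θ) hA (zero_le_two (α := ℝ))
    (by linarith : 0 ≤ 2 * a - 2)
  have h2 := lintegral_ofReal_add_indicator (π.law μ θ') hA (zero_le_one (α := ℝ)) ha2
  have hm : Measurable fun h : History n T =>
      ENNReal.ofReal (1 + B.indicator (fun _ => a ^ 2 - 1) h) :=
    (measurable_const.add (measurable_const.indicator hB)).ennreal_ofReal
  have hc := π.lintegral_law_change μ θ θ' T hm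
  have h3 : ENNReal.ofReal (2 + (2 * a - 2) * (π.law μ θ).real (prefixOf T ⁻¹' B))
      ≤ ENNReal.ofReal (Real.exp (2 * d * T))
        + ENNReal.ofReal (1 + (a ^ 2 - 1) * (π.law μ θ').real (prefixOf T ⁻¹' B)) := by
    have mp := measurable_prefixOf (n := n) T
    rw [← h1, ← h2]
    change _ ≤ _ + ∫⁻ ω, ENNReal.ofReal
      (1 + B.indicator (fun _ => a ^ 2 - 1) (prefixOf T ω)) ∂π.law μ θ'
    rw [hc]
    refine le_trans ?_ (add_le_add_left (π.lintegral_exp_logLik_le μ θ θ' hd T) _)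
    rw [← lintegral_add_left (by fun_prop)]
    refine lintegral_mono fun ω => ?_
    change ENNReal.ofReal (2 + B.indicator (fun _ => 2 * a - 2) (prefixOf T ω)) ≤ _
    set l := logLik μ θ θ' (prefixOf T ω)
    -- With g equal to a on B and 1 off B, the pointwise claim is 2g ≤ eˡ + g²e⁻ˡ, that is, AM-GM;
    -- the last term integrates under θ to the integral of g² under θ'.
    obtain ⟨g, hg1, hg2⟩ : ∃ g : ℝ, 2 + B.indicator (fun _ => 2 * a - 2) (prefixOf T ω) = 2 * g ∧
        1 + B.indicator (fun _ => a ^ 2 - 1) (prefixOf T ω) = g ^ 2 := by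
      by_cases hω : prefixOf T ω ∈ B
      · exact ⟨a, by simp [hω], by simp [hω]⟩
      · exact ⟨1, by simp [hω], by simp [hω]⟩
    rw [hg1, hg2, ← ENNReal.ofReal_mul (sq_nonneg g),
      ← ENNReal.ofReal_add (Real.exp_pos _).le (by positivity)]
    refine ENNReal.ofReal_le_ofReal ?_
    have he : Real.exp (1 * l) = (Real.exp (l / 2)) ^ 2 := by
      rw [← Real.exp_nat_mul]; congr 1; push_cast; ring
    have he' : Real.exp (-l) = (Real.exp (-(l / 2))) ^ 2 := by
      rw [← Real.exp_nat_mul]; congr 1; push_cast; ring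
    have hee : Real.exp (l / 2) * Real.exp (-(l / 2)) = 1 := by
      rw [← Real.exp_add]; simp
    rw [he, he']
    have hg : g * (Real.exp (l / 2) * Real.exp (-(l / 2))) = g := by rw [hee, mul_one]
    nlinarith [sq_nonneg (Real.exp (l / 2) - g * Real.exp (-(l / 2)))]
  rw [← ENNReal.ofReal_add (Real.exp_pos _).le (by positivity)] at h3
  exact (ENNReal.ofReal_le_ofReal_iff (by positivity)).1 h3

/-- The left side of `hx` equals 1 + (1/2 - δ)²/δ, and Bernoulli's inequality bounds (1/δ)^k by 1 +
k(1/δ - 1) for k = (1/2 - δ₀)². Dropping the summand δ would lose the bound for δ ≥ 1/4, where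
1/(4δ) ≤ 1. -/
theorem mul_log_le_of_inv_add_le_exp {δ δ₀ x : ℝ} (hδ : 0 < δ) (hδ₀ : δ ≤ δ₀)
    (h2 : δ₀ < 1 / 2) (hx : 1 / (4 * δ) + δ ≤ Real.exp x) :
    (1 / 2 - δ₀) ^ 2 * Real.log (1 / δ) ≤ x := by
  rw [← Real.log_rpow (by positivity), Real.log_le_iff_le_exp (by positivity)]
  refine le_trans ?_ hx
  have hk : (1 / 2 - δ₀) ^ 2 ≤ (1 / 2 - δ) ^ 2 := by nlinarith
  have hk0 := sq_nonneg (1 / 2 - δ₀)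
  have hinv : 0 < 1 / δ := by positivity
  have hb := rpow_one_add_le_one_add_mul_self (s := 1 / δ - 1) (by linarith)
    hk0 (by nlinarith : (1 / 2 - δ₀) ^ 2 ≤ 1)
  rw [add_sub_cancel] at hb
  refine hb.trans ?_
  have h4 : 1 / (4 * δ) + δ = 1 + (1 / 2 - δ) ^ 2 * (1 / δ) := by field_simp; ring
  rw [h4]
  nlinarith

theorem expectedTime_ge (θ θ' : Fin J) (hne : θ' ≠ θ) {d δ δ₀ : ℝ} (hd0 : 0 < d)
    (hd : ∀ i, (μ i θ' - μ i θ) ^ 2 ≤ d) (hδ : 0 < δ) (hδ₀ : δ ≤ δ₀) (h2 : δ₀ < 1 / 2)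
    (hπ : π.IsDeltaPAC μ δ) :
    ENNReal.ofReal ((1 / 2 - δ₀) ^ 3 / 2 * (1 / d * Real.log (1 / δ)))
      ≤ π.expectedTime μ θ := by
  by_cases htop : π.expectedTime μ θ = ⊤
  · rw [htop]; exact le_top
  set e := (π.expectedTime μ θ).toReal with he
  have he0 : 0 ≤ e := ENNReal.toReal_nonneg
  rw [← ENNReal.ofReal_toReal htop, ← he]
  refine ENNReal.ofReal_le_ofReal ?_
  have hq : 0 < 1 / 2 - δ₀ := by linarith
  -- This horizon makes Markov's inequality bound the probability of not having stopped by 1/2 - δ₀;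
  -- adding the error δ ≤ δ₀ still leaves probability 1/2 for the correct decision.
  set T := ⌊e / (1 / 2 - δ₀)⌋₊ with hT
  have hT1 : (T : ℝ) ≤ e / (1 / 2 - δ₀) := Nat.floor_le (by positivity)
  have hT2 : e / (1 / 2 - δ₀) < T + 1 := Nat.lt_floor_add_one _
  rw [le_div_iff₀ hq] at hT1
  rw [div_lt_iff₀ hq] at hT2
  set A := prefixOf T ⁻¹' π.decidedSet T θ with hAdef
  have hA : MeasurableSet A := measurable_prefixOf T (π.measurableSet_decidedSet T θ)
  -- the correct decision is likely
  have hmk : (T + 1 : ℝ) * (π.law μ θ).real {ω | ∀ t ≤ T, prefixOf t ω ∉ π.haltSet t} ≤ e := by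
    have h := ENNReal.toReal_mono htop (π.mul_law_notHalted_le μ θ T)
    rw [ENNReal.toReal_mul] at h
    rwa [ENNReal.toReal_natCast, Nat.cast_add_one] at h
  have hcompl : (π.law μ θ).real Aᶜ
      ≤ (π.law μ θ).real {ω | ∀ t ≤ T, prefixOf t ω ∉ π.haltSet t} + δ := by
    have hw := ENNReal.toReal_mono ENNReal.ofReal_ne_top (hπ θ).2
    rw [ENNReal.toReal_ofReal hδ.le] at hw
    refine le_trans (measureReal_mono ?_) ((measureReal_union_le _ _).trans
      (add_le_add_right hw _))
    intro ω hω
    by_contra hcon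
    simp only [Set.mem_union, Set.mem_ofPred_eq, not_or, not_forall, not_exists, not_and,
      not_not] at hcon
    obtain ⟨⟨t, ht, hh⟩, hc⟩ := hcon
    have hle := π.stopTime_le hh
    obtain ⟨s, hs⟩ := ENat.ne_top_iff_exists.1 (ne_top_of_le_ne_top (ENat.natCast_ne_top t) hle)
    refine hω ((π.prefixOf_mem_decidedSet T θ ω).2 ⟨s, ?_, hs.symm, hc s hs.symm⟩)
    rw [← hs, Nat.cast_le] at hle
    omega
  have hP : 1 / 2 ≤ (π.law μ θ).real A := by
    rw [probReal_compl_eq_one_sub hA] at hcompl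
    set u := (π.law μ θ).real {ω | ∀ t ≤ T, prefixOf t ω ∉ π.haltSet t}
    have hu : u ≤ 1 / 2 - δ₀ := by
      by_contra hcon
      push Not at hcon
      have : (T + 1 : ℝ) * (1 / 2 - δ₀) < (T + 1 : ℝ) * u := by gcongr
      linarith
    linarith
  -- under the other hypothesis it is unlikely
  have hQ : (π.law μ θ').real A ≤ δ := by
    have hw := ENNReal.toReal_mono ENNReal.ofReal_ne_top (hπ θ').2
    rw [ENNReal.toReal_ofReal hδ.le] at hw
    refine le_trans (measureReal_mono ?_) hw
    intro ω hω
    obtain ⟨t, -, h1, h3⟩ := (π.prefixOf_mem_decidedSet T θ ω).1 hω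
    exact ⟨t, h1, h3 ▸ hne.symm⟩
  -- The weight a = 1/(2δ) is the ratio of the two bounds 1/2 and δ on the probability of `A`.
  have ha : 1 ≤ 1 / (2 * δ) := by
    rw [le_div_iff₀ (by positivity)]; linarith
  have hb := π.two_point_bound μ θ θ' hd T (π.measurableSet_decidedSet T θ) ha
  rw [← hAdef] at hb
  have hexp : 1 / (4 * δ) + δ ≤ Real.exp (2 * d * T) := by
    have h5 : (2 * (1 / (2 * δ)) - 2) * (1 / 2)
        ≤ (2 * (1 / (2 * δ)) - 2) * (π.law μ θ).real A := by
      gcongr; linarith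
    have h6 : ((1 / (2 * δ)) ^ 2 - 1) * (π.law μ θ').real A ≤ ((1 / (2 * δ)) ^ 2 - 1) * δ := by
      gcongr; nlinarith
    have h7 : ((1 / (2 * δ)) ^ 2 - 1) * δ = 1 / (4 * δ) - δ := by field_simp; ring
    have h8 : (2 * (1 / (2 * δ)) - 2) * (1 / 2) = 2 * (1 / (4 * δ)) - 1 := by field_simp; ring
    linarith
  have hlog := mul_log_le_of_inv_add_le_exp hδ hδ₀ h2 hexp
  rw [show (1 / 2 - δ₀) ^ 3 / 2 * (1 / d * Real.log (1 / δ))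
    = (1 / 2 - δ₀) * ((1 / 2 - δ₀) ^ 2 * Real.log (1 / δ)) / (2 * d) by field_simp,
    div_le_iff₀ (by positivity)]
  nlinarith [mul_le_mul_of_nonneg_left hlog hq.le, mul_le_mul_of_nonneg_left hT1 hd0.le]

/-- A policy that errs with probability less than `1` takes at least one sample. -/
theorem one_le_expectedTime (θ θ' : Fin J) (hne : θ' ≠ θ) {δ : ℝ} (hδ : δ < 1)
    (hπ : π.IsDeltaPAC μ δ) : 1 ≤ π.expectedTime μ θ := by
  have h0 : (Fin.elim0 : History n 0) ∉ π.haltSet 0 := by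
    intro hmem
    have hhalt : ∀ ω : ℕ → Round n, π.stopTime ω = (0 : ℕ) := fun ω => by
      rw [stopTime_eq_iff]
      exact ⟨by rwa [Subsingleton.elim (prefixOf 0 ω) Fin.elim0], by simp⟩
    -- A prediction without data is constant, so it is surely wrong under any other hypothesis φ.
    obtain ⟨φ, hφ⟩ : ∃ φ : Fin J, π.predict 0 Fin.elim0 ≠ φ := by
      by_cases h : π.predict 0 Fin.elim0 = θ
      · exact ⟨θ', fun h' => hne (h'.symm.trans h)⟩
      · exact ⟨θ, h⟩
    have hall : {ω | ∃ t : ℕ, π.stopTime ω = t ∧ π.predict t (prefixOf t ω) ≠ φ} = Set.univ :=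
      Set.eq_univ_of_forall fun ω => ⟨0, hhalt ω, by
        rwa [Subsingleton.elim (prefixOf 0 ω) Fin.elim0]⟩
    have h := (hπ φ).2
    rw [hall, measure_univ, ENNReal.one_le_ofReal] at h
    linarith
  have h := π.mul_law_notHalted_le μ θ 0
  have hall : {ω : ℕ → Round n | ∀ t ≤ 0, prefixOf t ω ∉ π.haltSet t} = Set.univ :=
    Set.eq_univ_of_forall fun ω t ht => by
      obtain rfl : t = 0 := by omega
      rwa [Subsingleton.elim (prefixOf 0 ω) Fin.elim0]
  rw [hall, measure_univ] at h
  simpa using h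

end Policy

/-! ### The environment -/

namespace IsHardEnv

variable {n J : ℕ} [NeZero n] {Γ : ℝ} {μ : Fin n → Fin J → ℝ}

theorem sub_first (hμ : IsHardEnv Γ μ) (θ θ' : Fin J) :
    μ 0 θ' - μ 0 θ = ((θ : ℝ) - (θ' : ℝ)) * (Γ / J) := by
  rw [hμ.first_arm, hμ.first_arm]
  ring

theorem sq_le_sq_first (hμ : IsHardEnv Γ μ) {θ θ' : Fin J} (hne : θ' ≠ θ) :
    (Γ / J) ^ 2 ≤ (μ 0 θ' - μ 0 θ) ^ 2 := by
  rw [hμ.sub_first, mul_pow]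
  -- Distinct indices differ by a nonzero integer; passing to ℤ turns positivity of the square into
  -- a bound by 1.
  have h1 : (1 : ℤ) ≤ ((θ : ℤ) - (θ' : ℤ)) ^ 2 := by
    have h : (θ : ℤ) - (θ' : ℤ) ≠ 0 := fun h => hne (Fin.ext (by omega))
    have := sq_pos_of_ne_zero h
    omega
  have h2 : (1 : ℝ) ≤ ((θ : ℝ) - (θ' : ℝ)) ^ 2 := by exact_mod_cast h1
  nlinarith [sq_nonneg (Γ / J)]

theorem sq_other_lt (hμ : IsHardEnv Γ μ) {i : Fin n} (hi : i ≠ 0) (θ θ' : Fin J) :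
    (μ i θ' - μ i θ) ^ 2 < (Γ / J) ^ 2 := by
  have h1 := abs_lt.1 (hμ.small i hi θ)
  have h2 := abs_lt.1 (hμ.small i hi θ')
  have h3 : Γ / J = 4 * (Γ / (4 * J)) := by
    have : (J : ℝ) ≠ 0 := by
      have := θ.pos
      positivity
    field_simp
  rw [h3]
  exact sq_lt_sq' (by linarith) (by linarith)

/-- Every hypothesis has a competitor from which no arm distinguishes it well. -/
theorem exists_neighbor (hμ : IsHardEnv Γ μ) (hJ : 2 ≤ J) (θ : Fin J) :
    ∃ θ' : Fin J, θ' ≠ θ ∧ ∀ i, (μ i θ' - μ i θ) ^ 2 ≤ (Γ / J) ^ 2 := by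
  obtain ⟨θ', hne, h1⟩ : ∃ θ' : Fin J, θ' ≠ θ ∧ ((θ : ℤ) - (θ' : ℤ)) ^ 2 = 1 := by
    -- The neighbor is the preceding index, or index 1 when there is none.
    by_cases h : (θ : ℕ) = 0
    · exact ⟨⟨1, hJ⟩, fun h' => by simp [← h'] at h, by simp [h]⟩
    · refine ⟨⟨θ - 1, by omega⟩, fun h' => by simp [Fin.ext_iff] at h'; omega, ?_⟩
      have : (θ : ℤ) - ((θ - 1 : ℕ) : ℤ) = 1 := by omega
      simp only [this]
      norm_num
  refine ⟨θ', hne, fun i => ?_⟩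
  by_cases hi : i = 0
  · subst hi
    rw [hμ.sub_first, mul_pow]
    have h2 : ((θ : ℝ) - (θ' : ℝ)) ^ 2 = 1 := by exact_mod_cast h1
    rw [h2, one_mul]
  · exact (hμ.sq_other_lt hi θ θ').le

theorem sq_other_lt_first (hμ : IsHardEnv Γ μ) {i : Fin n} (hi : i ≠ 0) {θ θ' : Fin J}
    (hne : θ' ≠ θ) : (μ i θ' - μ i θ) ^ 2 < (μ 0 θ' - μ 0 θ) ^ 2 :=
  (hμ.sq_other_lt hi θ θ').trans_le (hμ.sq_le_sq_first hne)

end IsHardEnv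

/-! ### Verification proportions -/

theorem sum_toReal_pmf {n : ℕ} (q : PMF (Fin n)) : ∑ i, (q i).toReal = 1 := by
  rw [← ENNReal.toReal_sum fun i _ => q.apply_ne_top i, ← tsum_fintype (L := .unconditional _),
    q.tsum_coe, ENNReal.toReal_one]

theorem sum_pure_mul {n : ℕ} [NeZero n] (f : Fin n → ℝ) :
    ∑ i, ((PMF.pure (0 : Fin n)) i).toReal * f i = f 0 := by
  rw [Finset.sum_eq_single 0]
  · simp
  · intro i _ hi
    simp [PMF.pure_apply, hi]
  · simp

theorem exists_ne_zero_of_ne_pure {n : ℕ} [NeZero n] {q : PMF (Fin n)}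
    (hq : q ≠ PMF.pure 0) : ∃ i, i ≠ 0 ∧ 0 < (q i).toReal := by
  by_contra hcon
  push Not at hcon
  have h0 : ∀ i, i ≠ 0 → q i = 0 := fun i hi => by
    have := le_antisymm (hcon i hi) ENNReal.toReal_nonneg
    exact (ENNReal.toReal_eq_zero_iff _).1 this |>.resolve_right (q.apply_ne_top i)
  refine hq (PMF.ext fun i => ?_)
  by_cases hi : i = 0
  · subst hi
    have h := q.tsum_coe
    rw [tsum_eq_single 0 h0] at h
    simp [h]
  · simp [PMF.pure_apply, hi, h0 i hi]

section Verification

variable {n J : ℕ} [NeZero n] {Γ : ℝ} {μ : Fin n → Fin J → ℝ}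

/-- Arm `0` has the largest gap against all competitors simultaneously, so the max-min problem
involves no trade-off between arms. -/
theorem IsHardEnv.sum_le_first (hμ : IsHardEnv Γ μ) (q : PMF (Fin n)) {θ θ' : Fin J}
    (hne : θ' ≠ θ) : ∑ i, (q i).toReal * (μ i θ' - μ i θ) ^ 2 ≤ (μ 0 θ' - μ 0 θ) ^ 2 := by
  rw [← one_mul ((μ 0 θ' - μ 0 θ) ^ 2), ← sum_toReal_pmf q, Finset.sum_mul]
  refine Finset.sum_le_sum fun i _ => mul_le_mul_of_nonneg_left ?_ ENNReal.toReal_nonneg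
  by_cases hi : i = 0
  · rw [hi]
  · exact (hμ.sq_other_lt_first hi hne).le

theorem IsHardEnv.sum_lt_first (hμ : IsHardEnv Γ μ) {q : PMF (Fin n)} (hq : q ≠ PMF.pure 0)
    {θ θ' : Fin J} (hne : θ' ≠ θ) :
    ∑ i, (q i).toReal * (μ i θ' - μ i θ) ^ 2 < (μ 0 θ' - μ 0 θ) ^ 2 := by
  rw [← one_mul ((μ 0 θ' - μ 0 θ) ^ 2), ← sum_toReal_pmf q, Finset.sum_mul]
  obtain ⟨i₀, hi₀, hpos⟩ := exists_ne_zero_of_ne_pure hq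
  refine Finset.sum_lt_sum
    (fun i _ => mul_le_mul_of_nonneg_left ?_ ENNReal.toReal_nonneg)
    ⟨i₀, Finset.mem_univ _, mul_lt_mul_of_pos_left (hμ.sq_other_lt_first hi₀ hne) hpos⟩
  by_cases hi : i = 0
  · rw [hi]
  · exact (hμ.sq_other_lt_first hi hne).le

/-- Pulling only the first arm is a verification proportion. -/
theorem IsHardEnv.isVerifProportion_pure (hμ : IsHardEnv Γ μ) (θ : Fin J) :
    IsVerifProportion μ θ (PMF.pure 0) := by
  intro q
  refine ciInf_mono (Set.finite_range _).bddBelow fun θ' => ?_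
  rw [sum_pure_mul fun i => (μ i θ' - μ i θ) ^ 2]
  exact hμ.sum_le_first q θ'.2

/-- Pulling only the first arm is the only verification proportion. -/
theorem IsHardEnv.eq_pure (hμ : IsHardEnv Γ μ) (hJ : 2 ≤ J) {θ : Fin J} {q : PMF (Fin n)}
    (hq : IsVerifProportion μ θ q) : q = PMF.pure 0 := by
  by_contra hne
  obtain ⟨φ, hφ, -⟩ := hμ.exists_neighbor hJ θ
  have : Nonempty {θ' : Fin J // θ' ≠ θ} := ⟨⟨φ, hφ⟩⟩
  -- At a competitor attaining the minimum for the point mass, q already does strictly worse, and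
  -- the minimum for q is no larger.
  obtain ⟨θ', hmin⟩ := exists_eq_ciInf_of_finite
    (f := fun θ' : {θ' : Fin J // θ' ≠ θ} =>
      ∑ i, ((PMF.pure (0 : Fin n)) i).toReal * (μ i θ' - μ i θ) ^ 2)
  have h1 : verifValue μ θ (PMF.pure 0) ≤ verifValue μ θ q := hq _
  have h2 : verifValue μ θ q ≤ ∑ i, (q i).toReal * (μ i θ' - μ i θ) ^ 2 :=
    ciInf_le (Set.finite_range _).bddBelow θ'
  have h3 := hμ.sum_lt_first hne θ'.2
  rw [sum_pure_mul fun i => (μ i θ' - μ i θ) ^ 2] at hmin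
  unfold verifValue at h1 h2
  linarith

end Verification

/-! ### Expected stopping times -/

namespace Policy

variable {n J : ℕ} (π : Policy n J) (μ : Fin n → Fin J → ℝ)

/-- The tail-sum formula, with τ > t relaxed to "the halting condition fails at time t". This leaves
events at single times, with no reference to the past. -/
theorem expectedTime_le_tsum (θ : Fin J) :
    π.expectedTime μ θ ≤ ∑' t, π.law μ θ (prefixOf t ⁻¹' (π.haltSet t)ᶜ) := by
  have hm (t : ℕ) : MeasurableSet (prefixOf t ⁻¹' (π.haltSet t)ᶜ) :=
    measurable_prefixOf t (π.measurableSet_haltSet t).compl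
  simp_rw [← fun t => lintegral_indicator_one (μ := π.law μ θ) (hm t)]
  rw [← lintegral_tsum fun t => (measurable_one.indicator (hm t)).aemeasurable]
  refine lintegral_mono fun ω => ?_
  have key (k : ℕ) (hk : (k : ℕ∞) ≤ π.stopTime ω) : (k : ℝ≥0∞)
      ≤ ∑' t, (prefixOf t ⁻¹' (π.haltSet t)ᶜ).indicator (1 : (ℕ → Round n) → ℝ≥0∞) ω := by
    have hmem (t : ℕ) (ht : t ∈ Finset.range k) : ω ∈ prefixOf t ⁻¹' (π.haltSet t)ᶜ := fun hh => by
      have := hk.trans (π.stopTime_le hh)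
      rw [Nat.cast_le] at this
      exact absurd (Finset.mem_range.1 ht) (by omega)
    refine le_trans (le_of_eq ?_) (ENNReal.sum_le_tsum (Finset.range k))
    rw [Finset.sum_congr rfl fun t ht => Set.indicator_of_mem (hmem t ht) _]
    simp
  cases h : π.stopTime ω with
  | top =>
    simp only [ENat.toENNReal_top, top_le_iff]
    exact ENNReal.eq_top_of_forall_nnreal_le fun r =>
      le_trans (by exact_mod_cast (Nat.le_ceil r)) (key ⌈r⌉₊ (by rw [h]; exact le_top))
  | coe k => simpa using key k h.ge

theorem ae_stopTime_ne_top {θ : Fin J} (h : π.expectedTime μ θ ≠ ⊤) :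
    ∀ᵐ ω ∂π.law μ θ, π.stopTime ω ≠ ⊤ := by
  rw [ae_iff]
  by_contra hne
  obtain ⟨T, hT⟩ := ENNReal.exists_nat_mul_gt hne h
  refine absurd hT (not_lt.2 (le_trans ?_ (π.mul_law_notHalted_le μ θ T)))
  refine mul_le_mul (by gcongr; omega) (measure_mono fun ω hω t _ hh => ?_) zero_le zero_le
  · simp only [not_not, Set.mem_ofPred_eq] at hω
    have := π.stopTime_le hh
    rw [hω, top_le_iff] at this
    exact ENat.natCast_ne_top t this

end Policy

/-- A series of terms that are at most `1` and decay geometrically after an initial stretch. -/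
theorem tsum_le_of_le_one_of_le_exp {u : ℕ → ℝ≥0∞} {a x : ℝ} (ha : 0 ≤ a) (hx : 0 < x)
    (h1 : ∀ t, u t ≤ 1) (h2 : ∀ t : ℕ, u t ≤ ENNReal.ofReal (Real.exp (a - (t + 1) * x))) :
    ∑' t, u t ≤ ENNReal.ofReal (a / x + 1 + 1 / x) := by
  -- From index m on the exponent is at most -(k + 1)x, with k counted from m.
  set m := ⌈a / x⌉₊ with hm
  have hm1 : a / x ≤ m := Nat.le_ceil _
  have hm2 : (m : ℝ) < a / x + 1 := Nat.ceil_lt_add_one (by positivity)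
  rw [div_le_iff₀ hx] at hm1
  rw [← ENNReal.summable.sum_add_tsum_nat_add' (f := u) (k := m)]
  have hr0 : 0 < Real.exp (-x) := Real.exp_pos _
  have hr1 : Real.exp (-x) < 1 := by rw [← Real.exp_zero]; exact Real.exp_lt_exp.2 (by linarith)
  have hgeo := (hasSum_geometric_of_lt_one hr0.le hr1).mul_left (Real.exp (-x))
  have htail : ∑' k, u (k + m) ≤ ENNReal.ofReal (1 / x) := by
    calc ∑' k, u (k + m)
        ≤ ∑' k : ℕ, ENNReal.ofReal (Real.exp (-x) * Real.exp (-x) ^ k) := by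
          refine ENNReal.tsum_le_tsum fun k => (h2 _).trans (ENNReal.ofReal_le_ofReal ?_)
          rw [← Real.exp_nat_mul, ← Real.exp_add, Real.exp_le_exp]
          push_cast
          nlinarith
      _ = ENNReal.ofReal (Real.exp (-x) * (1 - Real.exp (-x))⁻¹) := by
          rw [← ENNReal.ofReal_tsum_of_nonneg (fun k => by positivity) hgeo.summable,
            hgeo.tsum_eq]
      _ ≤ ENNReal.ofReal (1 / x) := by
          refine ENNReal.ofReal_le_ofReal ?_
          -- The geometric sum is 1/(eˣ - 1), and eˣ - 1 ≥ x.
          rw [← div_eq_mul_inv, div_le_div_iff₀ (by linarith) hx]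
          have h := Real.add_one_le_exp x
          have h' : Real.exp (-x) * Real.exp x = 1 := by rw [← Real.exp_add]; simp
          nlinarith
  have hhead : ∑ k ∈ Finset.range m, u k ≤ ENNReal.ofReal (a / x + 1) := by
    calc ∑ k ∈ Finset.range m, u k ≤ ∑ _k ∈ Finset.range m, 1 := Finset.sum_le_sum fun k _ => h1 k
      _ = ENNReal.ofReal m := by simp
      _ ≤ _ := ENNReal.ofReal_le_ofReal hm2.le
  rw [ENNReal.ofReal_add (by positivity) (by positivity)]
  exact add_le_add hhead htail

/-! ### Generalized Chernoff Sampling -/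

/-- If θ beat every competitor by more than the positive threshold, it would be the best fit and the
rule would stop. Used with the true hypothesis, this removes the estimate from the analysis. -/
theorem exists_logLik_le_of_notMem_gcsStop {n J : ℕ} {μ : Fin n → Fin J → ℝ}
    {δ : ℝ} (hpos : 0 < Real.log (J / δ)) {t : ℕ}
    (ht : 2 ≤ t) {h : History n t} (hh : h ∉ gcsStop μ δ t) (θ : Fin J) :
    ∃ θ' ≠ θ, logLik μ θ θ' h ≤ Real.log (J / δ) := by
  by_contra hcon
  push Not at hcon
  refine hh ⟨ht, θ, fun θ' => ?_, fun θ' hne => hcon θ' hne⟩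
  by_cases hne : θ' = θ
  · rw [hne]
  · have := hcon θ' hne
    unfold logLik at this
    linarith

theorem log_two_le_log_div {J : ℕ} {δ : ℝ} (hJ : 2 ≤ J) (hδ : 0 < δ) (hδ1 : δ < 1) :
    Real.log 2 ≤ Real.log (J / δ) := by
  refine Real.log_le_log two_pos ?_
  rw [le_div_iff₀ hδ]
  have : (2 : ℝ) ≤ J := by exact_mod_cast hJ
  nlinarith

section GCS

variable {n J : ℕ} [NeZero n] [NeZero J] {Γ : ℝ} {μ : Fin n → Fin J → ℝ}

/-- All proportions coincide, so the random estimate has no effect on the arm. -/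
theorem gcsSample_succ_apply (μ : Fin n → Fin J → ℝ) {p : Fin J → PMF (Fin n)}
    (hp : ∀ θ, p θ = PMF.pure 0) (t : ℕ) (h : History n (t + 1)) :
    gcsSample μ p (t + 1) h = Measure.dirac 0 := by
  have hk : armKernel p = Kernel.const _ (Measure.dirac 0) := by
    ext θ : 1
    change (p θ).toMeasure = _
    rw [hp, PMF.toMeasure_pure, Kernel.const_apply]
  rw [gcsSample, hk, Kernel.const_comp', Kernel.const_apply]

/-- The uniform first round may be uninformative and contributes only a factor at most 1; each of
the t later rounds pulls arm `0` and contributes exp(-(Γ/J)²/4). -/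
theorem lintegral_exp_neg_half_logLik_le (hμ : IsHardEnv Γ μ) {p : Fin J → PMF (Fin n)}
    (hp : ∀ θ, p θ = PMF.pure 0) (δ : ℝ) {θ θ' : Fin J} (hne : θ' ≠ θ) (t : ℕ) :
    ∫⁻ ω, ENNReal.ofReal (Real.exp (-(1 / 2) * logLik μ θ θ' (prefixOf (t + 1) ω)))
        ∂(gcs μ p δ).law μ θ
      ≤ ENNReal.ofReal (Real.exp (-(t * ((Γ / J) ^ 2 / 4)))) := by
  induction t with
  | zero =>
    refine ((gcs μ p δ).lintegral_exp_logLik_succ_le μ θ θ' (-(1 / 2)) 0 (b := 1)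
      fun h => ?_).trans (by rw [Policy.lintegral_exp_logLik_zero]; simp)
    calc _ ≤ ∫⁻ _, 1 ∂(gcs μ p δ).sample 0 h := by
          refine lintegral_mono fun i => ?_
          rw [ENNReal.ofReal_le_one, Real.exp_le_one_iff]
          nlinarith [sq_nonneg (μ i θ' - μ i θ)]
      _ = 1 := by simp
  | succ t ih =>
    refine ((gcs μ p δ).lintegral_exp_logLik_succ_le μ θ θ' (-(1 / 2)) (t + 1)
      (b := ENNReal.ofReal (Real.exp (-((Γ / J) ^ 2 / 4)))) fun h => ?_).trans ?_
    · rw [show (gcs μ p δ).sample (t + 1) h = Measure.dirac 0 from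
        gcsSample_succ_apply μ hp t h, lintegral_dirac]
      refine ENNReal.ofReal_le_ofReal (Real.exp_le_exp.2 ?_)
      linarith [hμ.sq_le_sq_first hne]
    · refine (mul_le_mul_left ih _).trans (le_of_eq ?_)
      rw [← ENNReal.ofReal_mul (Real.exp_pos _).le, ← Real.exp_add]
      congr 2
      push_cast
      ring

/-- A Chernoff bound at order -1/2 for each competitor, then a union bound. Since J ≤ J/δ, the
number of competitors costs one further log(J/δ), turning 1/2 into 3/2. -/
theorem law_notMem_gcsStop_le (hμ : IsHardEnv Γ μ) {p : Fin J → PMF (Fin n)}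
    (hp : ∀ θ, p θ = PMF.pure 0) {δ : ℝ} (hJ : 2 ≤ J) (hδ : 0 < δ) (hδ1 : δ < 1)
    (θ : Fin J) (t : ℕ) :
    (gcs μ p δ).law μ θ (prefixOf (t + 2) ⁻¹' (gcsStop μ δ (t + 2))ᶜ)
      ≤ ENNReal.ofReal
        (Real.exp (3 / 2 * Real.log (J / δ) - (t + 1) * ((Γ / J) ^ 2 / 4))) := by
  have hpos : 0 < Real.log (J / δ) :=
    (Real.log_pos one_lt_two).trans_le (log_two_le_log_div hJ hδ hδ1)
  set L := Real.log (J / δ) with hL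
  set x := (Γ / J) ^ 2 / 4 with hx
  have hJL : (J : ℝ) ≤ Real.exp L := by
    have hJ0 : (0 : ℝ) < J := by positivity
    rw [hL, Real.exp_log (by positivity), le_div_iff₀ hδ]
    nlinarith
  have hone (θ' : Fin J) (hne : θ' ≠ θ) :
      (gcs μ p δ).law μ θ {ω | logLik μ θ θ' (prefixOf (t + 2) ω) ≤ L}
        ≤ ENNReal.ofReal (Real.exp (L / 2 - (t + 1) * x)) := by
    have mp := measurable_prefixOf (n := n) (t + 2)
    have hM := mul_meas_ge_le_lintegral₀ (μ := (gcs μ p δ).law μ θ)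
      (f := fun ω => ENNReal.ofReal
        (Real.exp (-(1 / 2) * logLik μ θ θ' (prefixOf (t + 2) ω))))
      (by fun_prop) (ENNReal.ofReal (Real.exp (-(L / 2))))
    have hH := hM.trans (lintegral_exp_neg_half_logLik_le hμ hp δ hne (t + 1))
    have hsub : {ω : ℕ → Round n | logLik μ θ θ' (prefixOf (t + 2) ω) ≤ L}
        ⊆ {ω | ENNReal.ofReal (Real.exp (-(L / 2))) ≤ ENNReal.ofReal
          (Real.exp (-(1 / 2) * logLik μ θ θ' (prefixOf (t + 2) ω)))} := by
      intro ω hω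
      have hω' : logLik μ θ θ' (prefixOf (t + 2) ω) ≤ L := hω
      exact ENNReal.ofReal_le_ofReal (Real.exp_le_exp.2 (by linarith))
    refine (measure_mono hsub).trans ?_
    have h := mul_le_mul_right hH (ENNReal.ofReal (Real.exp (L / 2)))
    rw [← mul_assoc, ← ENNReal.ofReal_mul (Real.exp_pos _).le,
      ← ENNReal.ofReal_mul (Real.exp_pos _).le, ← Real.exp_add, ← Real.exp_add,
      add_neg_cancel, Real.exp_zero, ENNReal.ofReal_one, one_mul] at h
    refine h.trans (le_of_eq ?_)
    congr 2
    push_cast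
    ring
  calc (gcs μ p δ).law μ θ (prefixOf (t + 2) ⁻¹' (gcsStop μ δ (t + 2))ᶜ)
      ≤ (gcs μ p δ).law μ θ (⋃ θ' ∈ Finset.univ.erase θ,
          {ω | logLik μ θ θ' (prefixOf (t + 2) ω) ≤ L}) := by
        refine measure_mono fun ω hω => ?_
        obtain ⟨θ', hne, h⟩ := exists_logLik_le_of_notMem_gcsStop hpos (by omega) hω θ
        exact Set.mem_biUnion (Finset.mem_erase.2 ⟨hne, Finset.mem_univ _⟩) h
    _ ≤ ∑ θ' ∈ Finset.univ.erase θ,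
          (gcs μ p δ).law μ θ {ω | logLik μ θ θ' (prefixOf (t + 2) ω) ≤ L} :=
        measure_biUnion_finset_le _ _
    _ ≤ ∑ _θ' ∈ Finset.univ.erase θ, ENNReal.ofReal (Real.exp (L / 2 - (t + 1) * x)) :=
        Finset.sum_le_sum fun θ' h => hone θ' (Finset.ne_of_mem_erase h)
    _ ≤ ENNReal.ofReal J * ENNReal.ofReal (Real.exp (L / 2 - (t + 1) * x)) := by
        rw [Finset.sum_const, nsmul_eq_mul, ENNReal.ofReal_natCast]
        gcongr
        exact (Finset.card_le_univ _).trans_eq (Fintype.card_fin J)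
    _ ≤ ENNReal.ofReal (Real.exp (3 / 2 * L - (t + 1) * x)) := by
        rw [← ENNReal.ofReal_mul (Nat.cast_nonneg _)]
        refine ENNReal.ofReal_le_ofReal ?_
        rw [show 3 / 2 * L - (t + 1) * x = L + (L / 2 - (t + 1) * x) by ring, Real.exp_add]
        gcongr

theorem gcs_expectedTime_le (hμ : IsHardEnv Γ μ) (hΓ : 0 < Γ) {p : Fin J → PMF (Fin n)}
    (hp : ∀ θ, p θ = PMF.pure 0) {δ : ℝ} (hJ : 2 ≤ J) (hδ : 0 < δ) (hδ1 : δ < 1)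
    (θ : Fin J) :
    (gcs μ p δ).expectedTime μ θ
      ≤ ENNReal.ofReal (3 + 12 * ((J : ℝ) ^ 2 / Γ ^ 2 * Real.log (J / δ))) := by
  have hlog := log_two_le_log_div hJ hδ hδ1
  have hl2 := Real.log_two_gt_d9
  have hJ0 : (0 : ℝ) < J := by positivity
  have hL : 0 < Real.log (J / δ) := by linarith
  have htail := tsum_le_of_le_one_of_le_exp (a := 3 / 2 * Real.log (J / δ))
    (x := (Γ / J) ^ 2 / 4) (by linarith) (by positivity)
    (fun t => prob_le_one) (law_notMem_gcsStop_le hμ hp hJ hδ hδ1 θ)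
  refine ((gcs μ p δ).expectedTime_le_tsum μ θ).trans ?_
  rw [← ENNReal.summable.sum_add_tsum_nat_add' (k := 2)]
  have hhead : ∑ t ∈ Finset.range 2,
      (gcs μ p δ).law μ θ (prefixOf t ⁻¹' ((gcs μ p δ).haltSet t)ᶜ) ≤ ENNReal.ofReal 2 := by
    refine (Finset.sum_le_sum fun t _ => prob_le_one).trans ?_
    simp
  refine (add_le_add hhead htail).trans ?_
  rw [← ENNReal.ofReal_add two_pos.le (by positivity)]
  refine ENNReal.ofReal_le_ofReal ?_
  have h1 : 3 / 2 * Real.log (J / δ) / ((Γ / J) ^ 2 / 4)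
      = 6 * ((J : ℝ) ^ 2 / Γ ^ 2 * Real.log (J / δ)) := by field_simp; ring
  have h2 : 1 / ((Γ / J) ^ 2 / 4) = 4 * ((J : ℝ) ^ 2 / Γ ^ 2) := by field_simp
  rw [h1, h2]
  have h3 : 0 < (J : ℝ) ^ 2 / Γ ^ 2 := by positivity
  -- The term 4J²/Γ² is at most 6J²/Γ² · log(J/δ), because log 2 > 2/3.
  nlinarith

theorem logLik_gt_of_mem_decisionSet {p : Fin J → PMF (Fin n)} {δ : ℝ}
    (hpos : 0 < Real.log (J / δ)) {t : ℕ} {h : History n t} {θ θ' : Fin J} (hne : θ' ≠ θ)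
    (hh : h ∈ (gcs μ p δ).decisionSet t θ') : Real.log (J / δ) < logLik μ θ' θ h := by
  obtain ⟨⟨-, φ, -, hφ⟩, -, hpred⟩ := hh
  have hbest : θ' ∈ bestFit μ h := hpred ▸ (bestFit_nonempty μ h).some_mem
  -- The prediction is an arbitrary best fit; the positive threshold rules out ties with the
  -- hypothesis φ of the stopping rule.
  obtain rfl : θ' = φ := by
    by_contra hn
    have h1 := hφ θ' hn
    have h2 := hbest φ
    linarith
  exact hφ θ hne.symm

/-- Deciding for a wrong θ' requires a likelihood ratio above J/δ in its favor, so under θ this has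
at most δ/J times its probability under θ'. A union over the competitors gives δ. -/
theorem gcs_error_le {p : Fin J → PMF (Fin n)} {δ : ℝ} (hJ : 2 ≤ J) (hδ : 0 < δ)
    (hδ1 : δ < 1) (θ : Fin J) :
    (gcs μ p δ).law μ θ {ω | ∃ t : ℕ, (gcs μ p δ).stopTime ω = t ∧
      (gcs μ p δ).predict t (prefixOf t ω) ≠ θ} ≤ ENNReal.ofReal δ := by
  set π := gcs μ p δ with hπ
  have hpos : 0 < Real.log (J / δ) :=
    (Real.log_pos one_lt_two).trans_le (log_two_le_log_div hJ hδ hδ1)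
  have hJ0 : (0 : ℝ) < J := by positivity
  have hexp : Real.exp (-Real.log (J / δ)) = δ / J := by
    rw [Real.exp_neg, Real.exp_log (by positivity), inv_div]
  have hms (t : ℕ) (θ' : Fin J) : MeasurableSet (prefixOf t ⁻¹' π.decisionSet t θ') :=
    measurable_prefixOf t (π.measurableSet_decisionSet t θ')
  have hstep (θ' : Fin J) (hne : θ' ≠ θ) (t : ℕ) :
      π.law μ θ (prefixOf t ⁻¹' π.decisionSet t θ')
        ≤ ENNReal.ofReal (δ / J) * π.law μ θ' (prefixOf t ⁻¹' π.decisionSet t θ') := by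
    rw [← lintegral_indicator_one (hms t θ'), ← lintegral_indicator_const (hms t θ')]
    refine (π.lintegral_law_change μ θ' θ t
      (F := (π.decisionSet t θ').indicator 1)
      (measurable_one.indicator (π.measurableSet_decisionSet t θ'))).trans_le ?_
    refine lintegral_mono fun ω => ?_
    by_cases hω : prefixOf t ω ∈ π.decisionSet t θ'
    · rw [Set.indicator_of_mem hω, Set.indicator_of_mem (s := prefixOf t ⁻¹' _) hω,
        Pi.one_apply, one_mul, ← hexp]
      exact ENNReal.ofReal_le_ofReal (Real.exp_le_exp.2
        (neg_le_neg (logLik_gt_of_mem_decisionSet hpos hne hω).le))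
    · rw [Set.indicator_of_notMem hω, zero_mul]
      exact zero_le
  have hone (θ' : Fin J) (hne : θ' ≠ θ) :
      π.law μ θ (⋃ t, prefixOf t ⁻¹' π.decisionSet t θ') ≤ ENNReal.ofReal (δ / J) := by
    refine (measure_iUnion_le _).trans ((ENNReal.tsum_le_tsum (hstep θ' hne)).trans ?_)
    rw [ENNReal.tsum_mul_left]
    refine mul_le_of_le_one_right' ?_
    rw [← measure_univ (μ := π.law μ θ')]
    -- Decisions at different times are disjoint events, so their probabilities under θ' sum to at
    -- most 1.
    refine tsum_measure_le_measure_univ (fun t => (hms t θ').nullMeasurableSet)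
      fun s t hst => Disjoint.aedisjoint (Set.disjoint_left.2 fun ω hs ht => hst ?_)
    have h1 := ((π.prefixOf_mem_decisionSet s θ' ω).1 hs).1
    have h2 := ((π.prefixOf_mem_decisionSet t θ' ω).1 ht).1
    exact_mod_cast h1.symm.trans h2
  calc _ ≤ π.law μ θ (⋃ θ' ∈ Finset.univ.erase θ, ⋃ t, prefixOf t ⁻¹' π.decisionSet t θ') := by
        refine measure_mono fun ω hω => ?_
        obtain ⟨t, h1, h2⟩ := hω
        exact Set.mem_biUnion (Finset.mem_erase.2 ⟨h2, Finset.mem_univ _⟩)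
          (Set.mem_iUnion.2 ⟨t, (π.prefixOf_mem_decisionSet t _ ω).2 ⟨h1, rfl⟩⟩)
    _ ≤ ∑ θ' ∈ Finset.univ.erase θ, π.law μ θ (⋃ t, prefixOf t ⁻¹' π.decisionSet t θ') :=
        measure_biUnion_finset_le _ _
    _ ≤ ∑ _θ' ∈ Finset.univ.erase θ, ENNReal.ofReal (δ / J) :=
        Finset.sum_le_sum fun θ' h => hone θ' (Finset.ne_of_mem_erase h)
    _ ≤ ENNReal.ofReal J * ENNReal.ofReal (δ / J) := by
        rw [Finset.sum_const, nsmul_eq_mul, ENNReal.ofReal_natCast]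
        gcongr
        exact (Finset.card_le_univ _).trans_eq (Fintype.card_fin J)
    _ = ENNReal.ofReal δ := by
        rw [← ENNReal.ofReal_mul hJ0.le, mul_div_cancel₀ _ hJ0.ne']

theorem gcs_isDeltaPAC (hμ : IsHardEnv Γ μ) (hΓ : 0 < Γ) {p : Fin J → PMF (Fin n)}
    (hp : ∀ θ, p θ = PMF.pure 0) {δ : ℝ} (hJ : 2 ≤ J) (hδ : 0 < δ) (hδ1 : δ < 1) :
    (gcs μ p δ).IsDeltaPAC μ δ := fun θ =>
  ⟨(gcs μ p δ).ae_stopTime_ne_top μ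
    (ne_top_of_le_ne_top ENNReal.ofReal_ne_top (gcs_expectedTime_le hμ hΓ hp hJ hδ hδ1 θ)),
    gcs_error_le hJ hδ hδ1 θ⟩

end GCS

theorem IsHardEnv.expectedTime_ge {n J : ℕ} [NeZero n] {Γ : ℝ} {μ : Fin n → Fin J → ℝ}
    (hμ : IsHardEnv Γ μ) (hΓ : 0 < Γ) (hJ : 2 ≤ J) {δ δ₀ : ℝ} (hδ : 0 < δ) (hδ₀ : δ ≤ δ₀)
    (h2 : δ₀ < 1 / 2) {π : Policy n J} (hπ : π.IsDeltaPAC μ δ) (θ : Fin J) :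
    ENNReal.ofReal ((1 / 2 - δ₀) ^ 3 / 2 * ((J : ℝ) ^ 2 / Γ ^ 2 * Real.log (1 / δ)))
      ≤ π.expectedTime μ θ := by
  obtain ⟨θ', hne, hd⟩ := hμ.exists_neighbor hJ θ
  have hJ0 : (0 : ℝ) < J := by positivity
  have h := π.expectedTime_ge μ θ θ' hne (by positivity) hd hδ hδ₀ h2 hπ
  rwa [show 1 / (Γ / J) ^ 2 = (J : ℝ) ^ 2 / Γ ^ 2 by field_simp] at h

end ActiveTesting

end

theorem theorem4 :
    -- lower bound for every δ-PAC policy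
    (∀ δ₀ : ℝ, δ₀ < 1 / 2 → ∃ c : ℝ, 0 < c ∧
      ∀ (n J : ℕ) [NeZero n] [NeZero J], 2 ≤ J →
      ∀ (Γ : ℝ), 0 < Γ → ∀ (μ : Fin n → Fin J → ℝ), ActiveTesting.IsHardEnv Γ μ →
      ∀ (δ : ℝ), 0 < δ → δ ≤ δ₀ →
      ∀ (π : ActiveTesting.Policy n J), π.IsDeltaPAC μ δ → ∀ θ : Fin J,
        ENNReal.ofReal (c * ((J : ℝ) ^ 2 / Γ ^ 2 * Real.log (1 / δ))) ≤ π.expectedTime μ θ) ∧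
    -- Generalized Chernoff Sampling is well defined, δ-PAC and satisfies the upper bound
    (∃ C : ℝ, 0 < C ∧
      ∀ (n J : ℕ) [NeZero n] [NeZero J], 2 ≤ J →
      ∀ (Γ : ℝ), 0 < Γ → ∀ (μ : Fin n → Fin J → ℝ), ActiveTesting.IsHardEnv Γ μ →
      (∀ θ : Fin J, ∃ q : PMF (Fin n), ActiveTesting.IsVerifProportion μ θ q) ∧
      ∀ (p : Fin J → PMF (Fin n)), (∀ θ, ActiveTesting.IsVerifProportion μ θ (p θ)) →
      ∀ (δ : ℝ), 0 < δ → δ < 1 →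
        (ActiveTesting.gcs μ p δ).IsDeltaPAC μ δ ∧
        ∀ θ : Fin J,
          (ActiveTesting.gcs μ p δ).expectedTime μ θ
            ≤ ENNReal.ofReal (C * (1 + (J : ℝ) ^ 2 / Γ ^ 2 * Real.log (J / δ))) ∧
          (Γ ≤ J → (ActiveTesting.gcs μ p δ).expectedTime μ θ
            ≤ ENNReal.ofReal (C * ((J : ℝ) ^ 2 / Γ ^ 2 * Real.log (J / δ))))) ∧
    -- Generalized Chernoff Sampling is optimal up to constants
    (∀ δ₀ : ℝ, δ₀ < 1 / 2 → ∃ K : ℝ, 0 < K ∧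
      ∀ (n J : ℕ) [NeZero n] [NeZero J], 2 ≤ J →
      ∀ (Γ : ℝ), 0 < Γ → ∀ (μ : Fin n → Fin J → ℝ), ActiveTesting.IsHardEnv Γ μ →
      ∀ (p : Fin J → PMF (Fin n)), (∀ θ, ActiveTesting.IsVerifProportion μ θ (p θ)) →
      ∀ (δ : ℝ), 0 < δ → δ ≤ δ₀ → δ ≤ 1 / J →
      ∀ (π : ActiveTesting.Policy n J), π.IsDeltaPAC μ δ → ∀ θ : Fin J,
        (ActiveTesting.gcs μ p δ).expectedTime μ θ
          ≤ ENNReal.ofReal K * π.expectedTime μ θ) := by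
  refine ⟨fun δ₀ h2 => ⟨(1 / 2 - δ₀) ^ 3 / 2, ?_, ?_⟩, ⟨20, by norm_num, ?_⟩,
    -- In K, the 3 is paid for by the bound 1 ≤ 𝔼[τ]; 24 is the 12 of the upper bound doubled by
    -- log(J/δ) ≤ 2 log(1/δ), and the last factor inverts the lower-bound constant.
    fun δ₀ h2 => ⟨3 + 24 * (2 / (1 / 2 - δ₀) ^ 3), ?_, ?_⟩⟩
  · have : 0 < 1 / 2 - δ₀ := by linarith
    positivity
  · intro n J _ _ hJ Γ hΓ μ hμ δ hδ hδ₀ π hπ θ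
    exact hμ.expectedTime_ge hΓ hJ hδ hδ₀ h2 hπ θ
  · intro n J _ _ hJ Γ hΓ μ hμ
    refine ⟨fun θ => ⟨_, hμ.isVerifProportion_pure θ⟩, fun p hp δ hδ hδ1 => ?_⟩
    have hp' : ∀ θ, p θ = PMF.pure 0 := fun θ => hμ.eq_pure hJ (hp θ)
    refine ⟨ActiveTesting.gcs_isDeltaPAC hμ hΓ hp' hJ hδ hδ1, fun θ => ?_⟩
    have hE := ActiveTesting.gcs_expectedTime_le hμ hΓ hp' hJ hδ hδ1 θ
    have hlog := ActiveTesting.log_two_le_log_div hJ hδ hδ1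
    have hl2 := Real.log_two_gt_d9
    have hx : 0 < (J : ℝ) ^ 2 / Γ ^ 2 := by
      have : (0 : ℝ) < J := by positivity
      positivity
    have hL : 0 < Real.log (J / δ) := by linarith
    have hxL := mul_pos hx hL
    refine ⟨hE.trans (ENNReal.ofReal_le_ofReal (by linarith)),
      fun hΓJ => hE.trans (ENNReal.ofReal_le_ofReal ?_)⟩
    -- With log(J/δ) ≥ log 2 this bounds the main term below by log 2 > 3/8, so the surplus 20 - 12
    -- absorbs the additive 3.
    have hx1 : 1 ≤ (J : ℝ) ^ 2 / Γ ^ 2 := by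
      rw [one_le_div (by positivity)]
      gcongr
    nlinarith
  · have : 0 < 1 / 2 - δ₀ := by linarith
    positivity
  · intro n J _ _ hJ Γ hΓ μ hμ p hp δ hδ hδ₀ hδJ π hπ θ
    have hp' : ∀ θ, p θ = PMF.pure 0 := fun θ => hμ.eq_pure hJ (hp θ)
    have hJ0 : (0 : ℝ) < J := by positivity
    have hq : 0 < 1 / 2 - δ₀ := by linarith
    have hE := ActiveTesting.gcs_expectedTime_le hμ hΓ hp' hJ hδ (by linarith) θ
    have hlow := hμ.expectedTime_ge hΓ hJ hδ hδ₀ h2 hπ θ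
    obtain ⟨θ', hne, -⟩ := hμ.exists_neighbor hJ θ
    have hone := π.one_le_expectedTime μ θ θ' hne (by linarith : δ < 1) hπ
    set y := (J : ℝ) ^ 2 / Γ ^ 2 * Real.log (1 / δ) with hy
    have hy0 : 0 ≤ y := by
      refine mul_nonneg (by positivity) (Real.log_nonneg ?_)
      rw [le_div_iff₀ hδ]
      linarith
    have hlog : Real.log (J / δ) ≤ 2 * Real.log (1 / δ) := by
      rw [div_eq_mul_one_div, Real.log_mul hJ0.ne' (by positivity)]
      have : Real.log J ≤ Real.log (1 / δ) := by
        refine Real.log_le_log hJ0 ?_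
        rwa [le_one_div hJ0 hδ]
      linarith
    have hK (q : ℝ) (hq : 0 < q) : 24 * (2 / q ^ 3) * (q ^ 3 / 2 * y) = 24 * y := by
      field_simp
    calc (ActiveTesting.gcs μ p δ).expectedTime μ θ
        ≤ ENNReal.ofReal (3 + 24 * y) := by
          refine hE.trans (ENNReal.ofReal_le_ofReal ?_)
          have h := mul_le_mul_of_nonneg_left hlog
            (by positivity : 0 ≤ (J : ℝ) ^ 2 / Γ ^ 2)
          linarith
      _ = ENNReal.ofReal 3 * 1 + ENNReal.ofReal (24 * (2 / (1 / 2 - δ₀) ^ 3))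
            * ENNReal.ofReal ((1 / 2 - δ₀) ^ 3 / 2 * y) := by
          rw [← ENNReal.ofReal_mul (by positivity), mul_one,
            ENNReal.ofReal_add (by norm_num) (by positivity)]
          rw [hK _ hq]
      _ ≤ ENNReal.ofReal 3 * π.expectedTime μ θ
            + ENNReal.ofReal (24 * (2 / (1 / 2 - δ₀) ^ 3)) * π.expectedTime μ θ := by
          gcongr
      _ = _ := by
          rw [← add_mul, ← ENNReal.ofReal_add (by norm_num) (by positivity)]
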